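/- Let $n\ge 1$, let $C(S^1)^{(n)}\subseteq M_n(\mathbb C)$ be the operator system of complex $n\times n$ Toeplitz matrices, and let $H\neq\{0\}$ be a complex Hilbert space of arbitrary (finite or infinite) dimension. Let $\mathcal C=\left(C(S^1)^{(n)}\otimes_{\min}B(H)\right)_+$ be the positive cone of the minimal (spatial) operator system tensor product, that is, the set of those elements of the algebraic tensor product $C(S^1)^{(n)}\otimes B(H)$ that act as positive operators on the Hilbert space $\mathbb C^n\otimes H$. An element $\phi\in\mathcal C$ is called pure (it generates an extremal ray of $\mathcal C$, the ray $\{0\}$ being admitted) if, whenever $\vartheta+\omega=\phi$ with $\vartheta,\omega\in\mathcal C$, there is $s\in[0,1]$ such that $\vartheta=s\phi$ and $\omega=(1-s)\phi$. For $z\in S^1$ let $T_n(z)=[z^{k-l}]_{k,l=1}^{n}\in C(S^1)^{(n)}$. Then an element $T\in C(S^1)^{(n)}\otimes B(H)$ is a pure element of $\mathcal C$ if and only if there exist $\lambda\in S^1$, a rank-one projection $Q\in B(H)$ (that is, $Q=Q^*=Q^2$ with one-dimensional range) and a real number $\alpha\ge 0$ such that $$T=T_n(\lambda^{-1})\otimes(\alpha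 Q).$$ -/

import Mathlib

open scoped TensorProduct

noncomputable section

/-- The space of `n × n` complex Toeplitz matrices: the `(k, l)` entry depends only on `k - l`. -/
def toeplitz (n : ℕ) : Submodule ℂ (Matrix (Fin n) (Fin n) ℂ) where
  carrier := {t | ∃ τ : ℤ → ℂ, ∀ k l : Fin n, t k l = τ ((k : ℤ) - (l : ℤ))}
  zero_mem' := ⟨0, fun _ _ => rfl⟩
  add_mem' := by
    rintro a b ⟨τ, hτ⟩ ⟨σ, hσ⟩
    exact ⟨τ + σ, fun k l => by simp [hτ, hσ]⟩
  smul_mem' := by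
    rintro c a ⟨τ, hτ⟩
    exact ⟨c • τ, fun k l => by simp [hτ]⟩

/-- The universal positive Toeplitz matrix `T_n(z)`, `z ∈ S¹`, with `(k, l)` entry `z ^ (k - l)`. -/
def universalToeplitz (n : ℕ) (z : Circle) : toeplitz n :=
  ⟨Matrix.of fun k l => (z : ℂ) ^ ((k : ℤ) - (l : ℤ)), fun m => (z : ℂ) ^ m, fun _ _ => rfl⟩

section Spatial

variable (n : ℕ) (H : Type*) [NormedAddCommGroup H] [InnerProductSpace ℂ H]

/-- The Hilbert space `ℂⁿ ⊗ H`, realised as the `ℓ²` direct sum of `n` copies of `H`. -/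
abbrev HilbertPower : Type _ := PiLp 2 (fun _ : Fin n => H)

variable {n H}

/-- The operator `a ⊗ x` on `ℂⁿ ⊗ H`, i.e. the operator matrix with `(i, j)` entry `a i j • x`. -/
def kroneckerOp (a : Matrix (Fin n) (Fin n) ℂ) (x : H →L[ℂ] H) :
    HilbertPower n H →L[ℂ] HilbertPower n H :=
  ((PiLp.continuousLinearEquiv 2 ℂ (fun _ : Fin n => H)).symm :
      (Fin n → H) →L[ℂ] HilbertPower n H) ∘L
    ContinuousLinearMap.pi fun i =>
      ∑ j, a i j • (x ∘L PiLp.proj 2 (fun _ : Fin n => H) j)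

theorem kroneckerOp_apply (a : Matrix (Fin n) (Fin n) ℂ) (x : H →L[ℂ] H)
    (ξ : HilbertPower n H) (i : Fin n) :
    kroneckerOp a x ξ i = ∑ j, a i j • x (ξ j) := by
  simp [kroneckerOp]

variable (n H)

/-- The spatial representation of the algebraic tensor product of the Toeplitz matrices with
`B(H)` as operators on `ℂⁿ ⊗ H`; it sends `∑ a_i ⊗ x_i` to the block Toeplitz operator. -/
def spatialRep :
    (toeplitz n ⊗[ℂ] (H →L[ℂ] H)) →ₗ[ℂ] (HilbertPower n H →L[ℂ] HilbertPower n H) :=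
  TensorProduct.lift <| LinearMap.mk₂ ℂ
    (fun (a : toeplitz n) (x : H →L[ℂ] H) => kroneckerOp (a : Matrix (Fin n) (Fin n) ℂ) x)
    (by intros; ext; simp [kroneckerOp_apply, add_smul, Finset.sum_add_distrib])
    (by intros; ext; simp [kroneckerOp_apply, mul_smul, Finset.smul_sum])
    (by intros; ext; simp [kroneckerOp_apply, Finset.sum_add_distrib])
    (by intro c a x; ext; simp [kroneckerOp_apply, Finset.smul_sum, smul_smul, mul_comm c])

/-- The positive cone of the minimal (spatial) operator system tensor product of the `n × n`
Toeplitz matrices with `B(H)`: the elements acting as positive operators on `ℂⁿ ⊗ H`. -/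
def minPositiveCone : ConvexCone ℝ (toeplitz n ⊗[ℂ] (H →L[ℂ] H)) where
  carrier := {T | (spatialRep n H T).IsPositive}
  smul_mem' := by
    intro c hc T hT
    have h : c • T = (c : ℂ) • T := (algebraMap_smul ℂ c T).symm
    simp only [Set.mem_ofPred_eq, h, map_smul] at hT ⊢
    exact hT.smul_of_nonneg (by exact_mod_cast hc.le)
  add_mem' := by
    intro S hS T hT
    simp only [Set.mem_ofPred_eq, map_add] at hS hT ⊢
    exact hS.add hT

end Spatial

/-- An element `φ` of a convex cone is pure (generates an extremal ray) if `ϑ + ω = φ` with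
`ϑ, ω` in the cone forces `ϑ = s φ` and `ω = (1 - s) φ` for some `s ∈ [0, 1]`. -/
def IsPureElement {E : Type*} [AddCommGroup E] [Module ℝ E] (C : ConvexCone ℝ E) (φ : E) : Prop :=
  φ ∈ C ∧ ∀ ϑ ∈ C, ∀ ω ∈ C, ϑ + ω = φ →
    ∃ s ∈ Set.Icc (0 : ℝ) 1, ϑ = s • φ ∧ ω = (1 - s) • φ

/-- A rank-one (orthogonal) projection on a Hilbert space. -/
def IsRankOneProjection {H : Type*} [NormedAddCommGroup H] [InnerProductSpace ℂ H]
    [CompleteSpace H] (Q : H →L[ℂ] H) : Prop :=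
  IsStarProjection Q ∧ Module.finrank ℂ (LinearMap.range (Q : H →ₗ[ℂ] H)) = 1

end

/-! The idea is to treat a pure `T` as a Gram matrix and perturb it by its own shift. Write the
block operator of `T` as `W† W`. Being Toeplitz means that the Gram kernel of the columns of `W` is
shift invariant, so a contraction `S` moves each column to the next and `S†` moves it back
(`IsBlockToeplitz.exists_shift`). Then `X = W† S W` and its adjoint `Y` are again block Toeplitz,
and for `|c| = 1` both `2T ± (cX + c̄Y)` are positive with sum `4T`. Purity at `c = 1` and `c = i`
forces `X = aT`, so consecutive block columns differ by the factor `a`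
(`IsPureElement.exists_block_succ`). Hence `|a| = 1` in the nondegenerate case, and `T` is an
elementary tensor of a universal Toeplitz matrix with a positive `P`. By Cauchy–Schwarz a nonzero
`P` dominates a rank-one operator, and purity makes `P` proportional to it.

Conversely, `T_n(z)` tensored with a rank-one positive operator is itself a rank-one positive
operator, extremal already among all positive operators. -/

open scoped TensorProduct

noncomputable section

/-! ### Positive operators, rank-one operators and contractions on a Hilbert space. -/

section Hilbert

variable {K : Type*} [NormedAddCommGroup K] [InnerProductSpace ℂ K] [CompleteSpace K]

open ContinuousLinearMap InnerProductSpace in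
/-- A positive operator factors as `W† W`. -/
theorem ContinuousLinearMap.IsPositive.exists_adjoint_comp_self {A : K →L[ℂ] K}
    (hA : A.IsPositive) : ∃ W : K →L[ℂ] K, A = adjoint W ∘L W := by
  rw [← nonneg_iff_isPositive] at hA
  obtain ⟨W, hW⟩ := CStarAlgebra.nonneg_iff_eq_star_mul_self.mp hA
  exact ⟨W, hW⟩

theorem ContinuousLinearMap.IsPositive.apply_eq_zero {A : K →L[ℂ] K} (hA : A.IsPositive) {x : K}
    (hx : inner ℂ x (A x) = 0) : A x = 0 := by
  obtain ⟨W, rfl⟩ := hA.exists_adjoint_comp_self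
  have : W x = 0 := by
    rw [← inner_self_eq_zero (𝕜 := ℂ), ← ContinuousLinearMap.adjoint_inner_right]
    exact hx
  simp [this]

open InnerProductSpace ComplexOrder in
/-- Rank-one positive operators generate extremal rays of the cone of positive operators. -/
theorem exists_eq_smul_rankOne_of_add_eq {A B : K →L[ℂ] K} (hA : A.IsPositive)
    (hB : B.IsPositive) {v : K} (h : A + B = rankOne ℂ v v) :
    ∃ s ∈ Set.Icc (0 : ℝ) 1, A = (s : ℂ) • rankOne ℂ v v := by
  -- On the complement of `v` the two nonnegative forms sum to zero, so each vanishes.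
  have hz : ∀ x, inner ℂ v x = 0 → A x = 0 := by
    intro x hx
    apply hA.apply_eq_zero
    have h1 : inner ℂ x (A x) + inner ℂ x (B x) = 0 := by
      rw [← inner_add_right, ← add_apply, h]
      simp [hx]
    have h2 := hA.inner_nonneg_right x
    have h3 := hB.inner_nonneg_right x
    exact ((add_eq_zero_iff_of_nonneg h2 h3).mp h1).1
  by_cases hv : v = 0
  · subst hv
    exact ⟨0, by simp, by ext x; simp [hz]⟩
  have hN : (0 : ℝ) < ‖v‖ ^ 2 := by positivity
  have hNC : ((‖v‖ : ℂ) ^ 2) ≠ 0 := by exact_mod_cast hN.ne'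
  have hvv : inner ℂ v v = (‖v‖ : ℂ) ^ 2 := inner_self_eq_norm_sq_to_K v
  obtain ⟨a, ha0, ha⟩ : ∃ a : ℝ, 0 ≤ a ∧ inner ℂ v (A v) = a := by
    obtain ⟨h1, h2⟩ := Complex.nonneg_iff.mp (hA.inner_nonneg_right v)
    exact ⟨_, h1, Complex.ext rfl (by simp [← h2])⟩
  obtain ⟨b, hb0, hb⟩ : ∃ b : ℝ, 0 ≤ b ∧ inner ℂ v (B v) = b := by
    obtain ⟨h1, h2⟩ := Complex.nonneg_iff.mp (hB.inner_nonneg_right v)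
    exact ⟨_, h1, Complex.ext rfl (by simp [← h2])⟩
  have hab : a + b = ‖v‖ ^ 2 * ‖v‖ ^ 2 := by
    have : inner ℂ v (A v) + inner ℂ v (B v) = (‖v‖ : ℂ) ^ 2 * (‖v‖ : ℂ) ^ 2 := by
      rw [← inner_add_right, ← add_apply, h, rankOne_apply, inner_smul_right, hvv]
    rw [ha, hb] at this
    exact_mod_cast this
  have hAv : A v = ((a / ‖v‖ ^ 2 : ℝ) : ℂ) • v := by
    -- The component `y` of `A v` orthogonal to `v` lies in the kernel of `A`, so `‖y‖² = ⟨A v, y⟩ =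
    -- ⟨v, A y⟩ = 0`.
    have hy : inner ℂ v (A v - ((a / ‖v‖ ^ 2 : ℝ) : ℂ) • v) = 0 := by
      rw [inner_sub_right, inner_smul_right, ha, hvv]
      push_cast
      rw [div_mul_cancel₀ _ hNC, sub_self]
    rw [← sub_eq_zero, ← inner_self_eq_zero (𝕜 := ℂ)]
    conv_lhs => rw [inner_sub_left, inner_smul_left, hy]
    rw [hA.inner_left_eq_inner_right, hz _ hy]
    simp
  refine ⟨a / ‖v‖ ^ 2 / ‖v‖ ^ 2, ⟨by positivity, ?_⟩, ?_⟩
  · rw [div_div, div_le_one (by positivity)]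
    linarith
  · ext x
    have hx : inner ℂ v (x - (inner ℂ v x / (‖v‖ : ℂ) ^ 2) • v) = 0 := by
      rw [inner_sub_right, inner_smul_right, hvv, div_mul_cancel₀ _ hNC, sub_self]
    have := hz _ hx
    rw [map_sub, map_smul, sub_eq_zero, hAv] at this
    rw [this]
    simp only [smul_apply, rankOne_apply, smul_smul]
    congr 1
    push_cast
    field_simp

open InnerProductSpace in
theorem IsRankOneProjection.exists_eq_rankOne {Q : K →L[ℂ] K} (hQ : IsRankOneProjection Q) :
    ∃ q : K, ‖q‖ = 1 ∧ Q = rankOne ℂ q q := by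
  obtain ⟨hQ, hr⟩ := hQ
  obtain ⟨⟨v, hv⟩, hv0, hspan⟩ := finrank_eq_one_iff'.mp hr
  have hv0' : v ≠ 0 := fun h => hv0 (Subtype.ext h)
  have hQv : Q v = v := by
    obtain ⟨w, rfl⟩ := hv
    exact congrArg (fun A : K →L[ℂ] K => A w) hQ.isIdempotentElem.eq
  have hsym : ∀ x y, inner ℂ (Q x) y = inner ℂ x (Q y) :=
    (ContinuousLinearMap.IsPositive.of_isStarProjection hQ).inner_left_eq_inner_right
  have hn : (‖v‖ : ℂ) ≠ 0 := by simpa using hv0'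
  refine ⟨(‖v‖ : ℂ)⁻¹ • v, by simp [norm_smul, hv0'], ?_⟩
  ext x
  obtain ⟨c, hc⟩ := hspan ⟨Q x, x, rfl⟩
  have hc : c • v = Q x := congrArg Subtype.val hc
  have h1 : inner ℂ v x = c * (‖v‖ : ℂ) ^ 2 := by
    rw [← hQv, hsym, ← hc, inner_smul_right]
    congr 1
    rw [hQv]
    exact inner_self_eq_norm_sq_to_K v
  rw [rankOne_apply, ← hc, inner_smul_left, h1, smul_smul]
  congr 1
  simp
  field_simp

open InnerProductSpace in
theorem isRankOneProjection_rankOne {q : K} (hq : ‖q‖ = 1) :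
    IsRankOneProjection (rankOne ℂ q q) := by
  have hq0 : q ≠ 0 := by rintro rfl; simp at hq
  refine ⟨isStarProjection_rankOne_self hq, ?_⟩
  rw [rankOne_def, ContinuousLinearMap.range_smulRight_apply]
  · exact finrank_span_singleton hq0
  · exact fun h => hq0 (by simpa using congrArg norm h)

open InnerProductSpace in
/-- If `P ≥ 0` and `P x ≠ 0` then `P` dominates a multiple of the rank-one operator of `P x`. -/
theorem ContinuousLinearMap.IsPositive.sub_rankOne {P : K →L[ℂ] K} (hP : P.IsPositive) (x : K) :
    (P - (((inner ℂ x (P x)).re⁻¹ : ℝ) : ℂ) • rankOne ℂ (P x) (P x)).IsPositive := by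
  obtain ⟨W, rfl⟩ := hP.exists_adjoint_comp_self
  have hx : (inner ℂ x ((adjoint W ∘L W) x)).re = ‖W x‖ ^ 2 := by
    rw [comp_apply, adjoint_inner_right, inner_self_eq_norm_sq_to_K]
    norm_cast
  rw [hx, isPositive_iff_complex]
  have key : ∀ y, inner ℂ ((adjoint W ∘L W - (((‖W x‖ ^ 2)⁻¹ : ℝ) : ℂ) •
      rankOne ℂ ((adjoint W ∘L W) x) ((adjoint W ∘L W) x)) y) y
      = ((‖W y‖ ^ 2 - (‖W x‖ ^ 2)⁻¹ * ‖inner ℂ (W x) (W y)‖ ^ 2 : ℝ) : ℂ) := by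
    intro y
    simp only [sub_apply, smul_apply, comp_apply, rankOne_apply, inner_sub_left, inner_smul_left,
      adjoint_inner_left, inner_self_eq_norm_sq_to_K]
    push_cast
    rw [← Complex.conj_mul']
    simp
  intro y
  rw [key]
  refine ⟨by rw [RCLike.re_to_complex, Complex.ofReal_re], ?_⟩
  rw [RCLike.re_to_complex, Complex.ofReal_re, sub_nonneg]
  -- When `W x = 0` the coefficient is `0⁻¹ = 0`; otherwise the claim is Cauchy–Schwarz for `W x`
  -- and `W y`.
  by_cases h : W x = 0
  · simp [h]
  · rw [inv_mul_le_iff₀ (by positivity), ← mul_pow]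
    gcongr
    exact norm_inner_le_norm _ _

/-- Operators with equal Gram kernels are intertwined by a contraction and its adjoint. -/
theorem exists_contraction_of_norm_eq {E : Type*} [AddCommGroup E] [Module ℂ E]
    (A B : E →ₗ[ℂ] K) (h : ∀ x, ‖A x‖ = ‖B x‖) :
    ∃ S : K →L[ℂ] K, ‖S‖ ≤ 1 ∧ (∀ x, S (A x) = B x) ∧
      ∀ x, ContinuousLinearMap.adjoint S (B x) = A x := by
  let M := (LinearMap.range A).topologicalClosure
  have : CompleteSpace M := (LinearMap.range A).isClosed_topologicalClosure.completeSpace_coe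
  let e : E →ₗ[ℂ] M := A.codRestrict M fun x =>
    (LinearMap.range A).le_topologicalClosure ⟨x, rfl⟩
  have hd : DenseRange e := by
    have hr : Set.range e = Subtype.val ⁻¹' (Set.range A) := by
      ext y
      simp only [Set.mem_range, Set.mem_preimage]
      exact exists_congr fun x => Subtype.ext_iff
    rw [DenseRange, hr, Subtype.dense_iff]
    intro y hy
    refine closure_mono ?_ hy
    rintro _ ⟨x, rfl⟩
    exact ⟨e x, ⟨x, rfl⟩, rfl⟩
  have hb : ∀ x, ‖B x‖ ≤ 1 * ‖e x‖ := fun x => by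
    rw [one_mul, ← h x]
    exact le_rfl
  -- `A x ↦ B x` is isometric; it is extended to the closure of the range of `A`, and by zero to the
  -- orthogonal complement.
  let S := B.extendOfNorm e ∘L M.orthogonalProjectionOnto
  have hS : ∀ x, S (A x) = B x := by
    intro x
    have : M.orthogonalProjectionOnto (A x) = e x :=
      Submodule.orthogonalProjectionOnto_mem_subspace_eq_self (e x)
    simp only [S, ContinuousLinearMap.comp_apply, this]
    exact LinearMap.extendOfNorm_eq hd ⟨1, hb⟩ x
  have hS1 : ‖S‖ ≤ 1 := by
    refine (ContinuousLinearMap.opNorm_comp_le _ _).trans ?_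
    have h1 := LinearMap.opNorm_extendOfNorm_le hd zero_le_one hb
    have h2 := M.orthogonalProjectionOnto_norm_le
    exact mul_le_one₀ h1 (norm_nonneg _) h2
  refine ⟨S, hS1, hS, fun x => ?_⟩
  -- Equality case of Cauchy–Schwarz: `S† B x` is no longer than `A x`, while its inner product with
  -- `A x` has real part `‖A x‖²`.
  have h1 : ‖ContinuousLinearMap.adjoint S (B x)‖ ≤ ‖A x‖ := by
    refine (ContinuousLinearMap.le_opNorm _ _).trans ?_
    rw [LinearIsometryEquiv.norm_map, h x]
    exact mul_le_of_le_one_left (norm_nonneg _) hS1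
  have h2 : RCLike.re (inner ℂ (ContinuousLinearMap.adjoint S (B x)) (A x)) = ‖A x‖ ^ 2 := by
    rw [ContinuousLinearMap.adjoint_inner_left, hS, h x]
    exact inner_self_eq_norm_sq _
  rw [← sub_eq_zero, ← norm_eq_zero, ← sq_eq_zero_iff]
  refine le_antisymm ?_ (sq_nonneg _)
  rw [norm_sub_sq (𝕜 := ℂ), h2]
  nlinarith [norm_nonneg (A x), norm_nonneg (ContinuousLinearMap.adjoint S (B x))]

/-- The operator `2 + c S + c̄ S†` is positive when `S` is a contraction and `|c| = 1`. -/
theorem isPositive_two_add_smul_add_adjoint {S : K →L[ℂ] K} (hS : ‖S‖ ≤ 1) {c : ℂ}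
    (hc : ‖c‖ = 1) : (2 • ContinuousLinearMap.id ℂ K + (c • S +
      (starRingEnd ℂ c) • ContinuousLinearMap.adjoint S)).IsPositive := by
  rw [ContinuousLinearMap.isPositive_iff_complex]
  have key : ∀ x, inner ℂ ((2 • ContinuousLinearMap.id ℂ K + (c • S +
      (starRingEnd ℂ c) • ContinuousLinearMap.adjoint S)) x) x
      = ((2 * ‖x‖ ^ 2 + 2 * (c * inner ℂ x (S x)).re : ℝ) : ℂ) := by
    intro x
    simp only [add_apply, smul_apply, inner_add_left,
      inner_smul_left, ContinuousLinearMap.adjoint_inner_left, Complex.conj_conj,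
      ContinuousLinearMap.id_apply]
    rw [← inner_conj_symm (S x) x, ← map_mul, add_comm (starRingEnd ℂ _), Complex.add_conj,
      two_smul, inner_add_left, inner_self_eq_norm_sq_to_K]
    push_cast
    simp only [Complex.coe_algebraMap]
    ring
  intro x
  rw [key]
  refine ⟨by rw [RCLike.re_to_complex, Complex.ofReal_re], ?_⟩
  rw [RCLike.re_to_complex, Complex.ofReal_re]
  have h1 : ‖c * inner ℂ x (S x)‖ ≤ ‖x‖ ^ 2 := by
    rw [norm_mul, hc, one_mul]
    refine (norm_inner_le_norm _ _).trans ?_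
    have := S.le_of_opNorm_le hS x
    nlinarith [norm_nonneg x]
  have h2 := (abs_le.mp (Complex.abs_re_le_norm (c * inner ℂ x (S x)))).1
  linarith

end Hilbert

/-! ### Block Toeplitz operators as the image of the tensor product. -/

section Blocks

variable {n : ℕ} {H : Type*} [NormedAddCommGroup H] [InnerProductSpace ℂ H]

/-- The inclusion of `H` as the `i`-th summand of `ℂⁿ ⊗ H`. -/
def blockIncl (i : Fin n) : H →L[ℂ] HilbertPower n H :=
  ((PiLp.continuousLinearEquiv 2 ℂ (fun _ : Fin n => H)).symm :
      (Fin n → H) →L[ℂ] HilbertPower n H) ∘L ContinuousLinearMap.single ℂ (fun _ : Fin n => H) i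

theorem blockIncl_apply (i j : Fin n) (x : H) :
    blockIncl i x j = if j = i then x else 0 := by
  simp [blockIncl]

theorem inner_blockIncl_left (i : Fin n) (x : H) (ξ : HilbertPower n H) :
    inner ℂ (blockIncl i x) ξ = inner ℂ x (ξ i) := by
  rw [PiLp.inner_apply, Finset.sum_eq_single i]
  · simp [blockIncl_apply]
  · intro j _ hj
    simp [blockIncl_apply, hj]
  · simp

theorem sum_blockIncl (ξ : HilbertPower n H) : ∑ i, blockIncl i (ξ i) = ξ := by
  ext j
  simp [blockIncl_apply]

/-- The `(i, j)` block of an operator on `ℂⁿ ⊗ H`. -/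
def block (i j : Fin n) : (HilbertPower n H →L[ℂ] HilbertPower n H) →ₗ[ℂ] (H →L[ℂ] H) where
  toFun G := PiLp.proj 2 (fun _ : Fin n => H) i ∘L G ∘L blockIncl j
  map_add' _ _ := by ext; simp
  map_smul' _ _ := by ext; simp

theorem block_apply (i j : Fin n) (G : HilbertPower n H →L[ℂ] HilbertPower n H) (x : H) :
    block i j G x = G (blockIncl j x) i := rfl

theorem inner_block (i j : Fin n) (G : HilbertPower n H →L[ℂ] HilbertPower n H) (x y : H) :
    inner ℂ x (block i j G y) = inner ℂ (blockIncl i x) (G (blockIncl j y)) := by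
  rw [inner_blockIncl_left, block_apply]

theorem block_ext {G G' : HilbertPower n H →L[ℂ] HilbertPower n H}
    (h : ∀ i j, block i j G = block i j G') : G = G' := by
  ext ξ i
  rw [← sum_blockIncl ξ]
  simp only [map_sum, WithLp.ofLp_sum, Finset.sum_apply]
  exact Finset.sum_congr rfl fun j _ => DFunLike.congr_fun (h i j) (ξ j)

theorem block_kroneckerOp (a : Matrix (Fin n) (Fin n) ℂ) (x : H →L[ℂ] H) (i j : Fin n) :
    block i j (kroneckerOp a x) = a i j • x := by
  ext y
  rw [block_apply, kroneckerOp_apply, Finset.sum_eq_single j]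
  · simp [blockIncl_apply]
  · intro k _ hk
    simp [blockIncl_apply, hk]
  · simp

theorem spatialRep_tmul (a : toeplitz n) (x : H →L[ℂ] H) :
    spatialRep n H (a ⊗ₜ x) = kroneckerOp (a : Matrix (Fin n) (Fin n) ℂ) x := rfl

theorem spatialRep_real_smul (s : ℝ) (T : toeplitz n ⊗[ℂ] (H →L[ℂ] H)) :
    spatialRep n H (s • T) = (s : ℂ) • spatialRep n H T := by
  rw [← algebraMap_smul ℂ s T, map_smul]
  rfl

/-- The operators on `ℂⁿ ⊗ H` whose blocks are constant along the diagonals. -/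
def IsBlockToeplitz (G : HilbertPower n H →L[ℂ] HilbertPower n H) : Prop :=
  ∃ τ : ℤ → (H →L[ℂ] H), ∀ i j : Fin n, block i j G = τ ((i : ℤ) - (j : ℤ))

theorem isBlockToeplitz_spatialRep (T : toeplitz n ⊗[ℂ] (H →L[ℂ] H)) :
    IsBlockToeplitz (spatialRep n H T) := by
  induction T with
  | zero => exact ⟨0, fun i j => by simp⟩
  | tmul a x =>
    obtain ⟨τ, hτ⟩ := a.2
    exact ⟨fun m => τ m • x, fun i j => by rw [spatialRep_tmul, block_kroneckerOp, hτ]⟩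
  | add S T hS hT =>
    obtain ⟨σ, hσ⟩ := hS
    obtain ⟨τ, hτ⟩ := hT
    exact ⟨σ + τ, fun i j => by rw [map_add, map_add, hσ, hτ, Pi.add_apply]⟩

theorem IsBlockToeplitz.smul {G : HilbertPower n H →L[ℂ] HilbertPower n H}
    (hG : IsBlockToeplitz G) (c : ℂ) : IsBlockToeplitz (c • G) := by
  obtain ⟨τ, hτ⟩ := hG
  exact ⟨c • τ, fun i j => by rw [map_smul, hτ, Pi.smul_apply]⟩

theorem IsBlockToeplitz.add {G G' : HilbertPower n H →L[ℂ] HilbertPower n H}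
    (hG : IsBlockToeplitz G) (hG' : IsBlockToeplitz G') : IsBlockToeplitz (G + G') := by
  obtain ⟨σ, hσ⟩ := hG
  obtain ⟨τ, hτ⟩ := hG'
  exact ⟨σ + τ, fun i j => by rw [map_add, hσ, hτ, Pi.add_apply]⟩

/-- With `d = i - j`, the position `(d⁺, d⁻)` lies in the first row or first column and serves as
the chosen representative of diagonal `d`. -/
theorem Fin.coe_ofNat_toNat_sub (i j : Fin (n + 1)) :
    ((Fin.ofNat (n + 1) ((i : ℤ) - j).toNat : Fin (n + 1)) : ℤ) -
      (Fin.ofNat (n + 1) (-((i : ℤ) - j)).toNat : Fin (n + 1)) = (i : ℤ) - j := by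
  have hi := i.isLt
  have hj := j.isLt
  simp only [Fin.val_ofNat]
  rw [Nat.mod_eq_of_lt (by omega), Nat.mod_eq_of_lt (by omega)]
  omega

/-- Constancy along diagonals may be checked between neighbouring blocks. -/
theorem isBlockToeplitz_of_succ {G : HilbertPower (n + 1) H →L[ℂ] HilbertPower (n + 1) H}
    (h : ∀ i j : Fin n, block i.succ j.succ G = block i.castSucc j.castSucc G) :
    IsBlockToeplitz G := by
  have key : ∀ m : ℕ, ∀ i j : ℕ, ∀ (hi : i + m < n + 1) (hj : j + m < n + 1),
      block ⟨i + m, hi⟩ ⟨j + m, hj⟩ G = block ⟨i, by omega⟩ ⟨j, by omega⟩ G := by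
    intro m
    induction m with
    | zero => intros; rfl
    | succ m ih =>
      intro i j hi hj
      rw [← ih i j (by omega) (by omega)]
      exact h ⟨i + m, by omega⟩ ⟨j + m, by omega⟩
  refine ⟨fun m => block (Fin.ofNat (n + 1) m.toNat) (Fin.ofNat (n + 1) (-m).toNat) G,
    fun i j => ?_⟩
  have hi := i.isLt
  have hj := j.isLt
  -- Slide `(i, j)` up its diagonal by `min i j` to reach the first row or column.
  have hk := key (min i j) ((i : ℤ) - j).toNat (-((i : ℤ) - j)).toNat (by omega) (by omega)
  convert hk using 3
  · exact Fin.ext (by simp only; omega)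
  · exact Fin.ext (by simp only; omega)
  · exact Fin.ext (Nat.mod_eq_of_lt (by omega))
  · exact Fin.ext (Nat.mod_eq_of_lt (by omega))

/-- The Toeplitz matrix with ones on the `m`-th diagonal and zeros elsewhere. -/
def toeplitzDiagonal (n : ℕ) (m : ℤ) : toeplitz n :=
  ⟨Matrix.of fun k l => if (k : ℤ) - (l : ℤ) = m then 1 else 0,
    fun j => if j = m then 1 else 0, fun _ _ => rfl⟩

/-- The element of the tensor product with the same blocks as a block Toeplitz operator. -/
def tensorOfOperator : (HilbertPower (n + 1) H →L[ℂ] HilbertPower (n + 1) H) →ₗ[ℂ]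
    toeplitz (n + 1) ⊗[ℂ] (H →L[ℂ] H) :=
  ∑ m ∈ Finset.Icc (-(n : ℤ)) n, TensorProduct.mk ℂ _ _ (toeplitzDiagonal (n + 1) m) ∘ₗ
    block (Fin.ofNat (n + 1) m.toNat) (Fin.ofNat (n + 1) (-m).toNat)

theorem sum_toeplitzDiagonal (a : toeplitz (n + 1)) :
    ∑ m ∈ Finset.Icc (-(n : ℤ)) n,
      (a : Matrix _ _ ℂ) (Fin.ofNat (n + 1) m.toNat) (Fin.ofNat (n + 1) (-m).toNat) •
        toeplitzDiagonal (n + 1) m = a := by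
  obtain ⟨t, τ, hτ⟩ := a
  ext i j
  have hi := i.isLt
  have hj := j.isLt
  rw [Submodule.coe_sum, Matrix.sum_apply, Finset.sum_eq_single ((i : ℤ) - j)]
  · simp only [toeplitzDiagonal, SetLike.val_smul, Matrix.smul_apply, Matrix.of_apply, if_true,
      smul_eq_mul, mul_one]
    rw [hτ, hτ, Fin.coe_ofNat_toNat_sub]
  · intro m _ hm
    simp [toeplitzDiagonal, hm.symm]
  · intro h
    exact absurd (Finset.mem_Icc.mpr (by omega)) h

theorem tensorOfOperator_spatialRep (T : toeplitz (n + 1) ⊗[ℂ] (H →L[ℂ] H)) :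
    tensorOfOperator (spatialRep (n + 1) H T) = T := by
  induction T with
  | zero => simp
  | add S T hS hT => rw [map_add, map_add, hS, hT]
  | tmul a x =>
    conv_rhs => rw [← sum_toeplitzDiagonal a]
    rw [TensorProduct.sum_tmul, tensorOfOperator, LinearMap.sum_apply]
    refine Finset.sum_congr rfl fun m _ => ?_
    rw [LinearMap.comp_apply, spatialRep_tmul, block_kroneckerOp, TensorProduct.mk_apply,
      TensorProduct.tmul_smul, TensorProduct.smul_tmul']

theorem spatialRep_injective : Function.Injective (spatialRep (n + 1) H) :=
  Function.LeftInverse.injective tensorOfOperator_spatialRep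

/-- This lets operators built by hand on `ℂⁿ ⊗ H` be fed back into the purity hypothesis. -/
theorem IsBlockToeplitz.exists_spatialRep_eq
    {G : HilbertPower (n + 1) H →L[ℂ] HilbertPower (n + 1) H} (hG : IsBlockToeplitz G) :
    ∃ T, spatialRep (n + 1) H T = G := by
  refine ⟨tensorOfOperator G, block_ext fun i j => ?_⟩
  obtain ⟨τ, hτ⟩ := hG
  have hi := i.isLt
  have hj := j.isLt
  rw [tensorOfOperator, LinearMap.sum_apply, map_sum, map_sum,
    Finset.sum_eq_single ((i : ℤ) - j)]
  · rw [LinearMap.comp_apply, TensorProduct.mk_apply, spatialRep_tmul, block_kroneckerOp, hτ, hτ,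
      Fin.coe_ofNat_toNat_sub]
    simp [toeplitzDiagonal]
  · intro m _ hm
    rw [LinearMap.comp_apply, TensorProduct.mk_apply, spatialRep_tmul, block_kroneckerOp]
    simp [toeplitzDiagonal, hm.symm]
  · intro h
    exact absurd (Finset.mem_Icc.mpr (by omega)) h

end Blocks

/-! ### Pure elements: the shift argument, reduction to `P`, and the converse. -/

section Purity

variable {n : ℕ} {H : Type*} [NormedAddCommGroup H] [InnerProductSpace ℂ H]

open ContinuousLinearMap

/-- A summand of a pure element is a multiple of it, phrased in the spatial representation. -/
theorem IsPureElement.exists_eq_smul {T : toeplitz (n + 1) ⊗[ℂ] (H →L[ℂ] H)}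
    (hT : IsPureElement (minPositiveCone (n + 1) H) T)
    {A B : HilbertPower (n + 1) H →L[ℂ] HilbertPower (n + 1) H} (hA : A.IsPositive)
    (hB : B.IsPositive) (hA' : IsBlockToeplitz A) (hB' : IsBlockToeplitz B)
    {c : ℝ} (hc : 0 < c) (h : A + B = (c : ℂ) • spatialRep (n + 1) H T) :
    ∃ r : ℝ, A = (r : ℂ) • spatialRep (n + 1) H T := by
  have hc' : (c : ℂ) ≠ 0 := by exact_mod_cast hc.ne'
  obtain ⟨a, ha⟩ := hA'.exists_spatialRep_eq
  obtain ⟨b, hb⟩ := hB'.exists_spatialRep_eq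
  have hAa : (spatialRep (n + 1) H a).IsPositive := ha ▸ hA
  have hBb : (spatialRep (n + 1) H b).IsPositive := hb ▸ hB
  have hTAB : spatialRep (n + 1) H T = (c : ℂ)⁻¹ • (A + B) := by
    rw [h, smul_smul, inv_mul_cancel₀ hc', one_smul]
  obtain ⟨s, -, hs, -⟩ := hT.2 (c⁻¹ • a)
    ((minPositiveCone (n + 1) H).smul_mem (inv_pos.mpr hc) hAa) (c⁻¹ • b)
    ((minPositiveCone (n + 1) H).smul_mem (inv_pos.mpr hc) hBb) (by
      apply spatialRep_injective
      rw [map_add, spatialRep_real_smul, spatialRep_real_smul, ha, hb, hTAB, Complex.ofReal_inv]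
      module)
  refine ⟨c * s, ?_⟩
  have := congrArg (spatialRep (n + 1) H) hs
  rw [spatialRep_real_smul, spatialRep_real_smul, ha] at this
  rw [Complex.ofReal_mul, mul_smul, ← this, smul_smul]
  simp [hc']

open InnerProductSpace in
theorem rankOne_real_smul (a : ℝ) (ha : 0 ≤ a) (q : H) :
    a • rankOne ℂ q q = rankOne ℂ (((√a : ℝ) : ℂ) • q) (((√a : ℝ) : ℂ) • q) := by
  ext x
  rw [smul_apply, rankOne_apply, rankOne_apply, inner_smul_left, smul_smul, Complex.conj_ofReal,
    mul_right_comm, ← Complex.ofReal_mul, Real.mul_self_sqrt ha, mul_smul, Complex.coe_smul]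

variable [CompleteSpace H]

theorem block_eq_adjoint_comp (i j : Fin n) (G : HilbertPower n H →L[ℂ] HilbertPower n H) :
    block i j G = adjoint (blockIncl i) ∘L G ∘L blockIncl j := by
  ext y
  refine ext_inner_left ℂ fun x => ?_
  rw [inner_block, comp_apply, adjoint_inner_right, comp_apply]

/-- The blocks of `W† X W` are the matrix coefficients of `X` between the columns of `W`. -/
theorem inner_block_conj (W X : HilbertPower n H →L[ℂ] HilbertPower n H) (i j : Fin n) (x y : H) :
    inner ℂ x (block i j (adjoint W ∘L X ∘L W) y) =
      inner ℂ (W (blockIncl i x)) (X (W (blockIncl j y))) := by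
  rw [inner_block, comp_apply, adjoint_inner_right, comp_apply]

/-- The columns of a factor `W` of a positive block Toeplitz operator `W† W` are shifted forward by
a contraction and backward by its adjoint. -/
theorem IsBlockToeplitz.exists_shift {W : HilbertPower (n + 1) H →L[ℂ] HilbertPower (n + 1) H}
    (hW : IsBlockToeplitz (adjoint W ∘L W)) :
    ∃ S : HilbertPower (n + 1) H →L[ℂ] HilbertPower (n + 1) H, ‖S‖ ≤ 1 ∧
      (∀ (j : Fin n) x, S (W (blockIncl j.castSucc x)) = W (blockIncl j.succ x)) ∧
      ∀ (j : Fin n) x, adjoint S (W (blockIncl j.succ x)) = W (blockIncl j.castSucc x) := by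
  obtain ⟨τ, hτ⟩ := hW
  -- `e = castSucc` omits the last column of `W`, `e = succ` the first; the two families have the
  -- same Gram kernel.
  let col (e : Fin n → Fin (n + 1)) : (Fin n → H) →ₗ[ℂ] HilbertPower (n + 1) H :=
    ∑ j, ((W ∘L blockIncl (e j) : H →L[ℂ] _) : H →ₗ[ℂ] _) ∘ₗ LinearMap.proj j
  have hcol : ∀ e x, col e x = ∑ j, W (blockIncl (e j) (x j)) := by
    intro e x
    simp [col]
  have hsingle : ∀ e j x, col e (Pi.single j x) = W (blockIncl (e j) x) := by
    intro e j x
    rw [hcol, Finset.sum_eq_single j]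
    · simp
    · intro k _ hk
      simp [hk]
    · simp
  have hgram : ∀ i j x y, inner ℂ (W (blockIncl i x)) (W (blockIncl j y)) =
      inner ℂ x (τ ((i : ℤ) - j) y) := by
    intro i j x y
    rw [← hτ, inner_block, comp_apply, adjoint_inner_right]
  have hnorm : ∀ x, ‖col Fin.castSucc x‖ = ‖col Fin.succ x‖ := by
    intro x
    have h : (inner ℂ (col Fin.castSucc x) (col Fin.castSucc x)) =
        inner ℂ (col Fin.succ x) (col Fin.succ x) := by
      simp only [hcol, sum_inner, inner_sum, hgram]
      refine Finset.sum_congr rfl fun i _ => Finset.sum_congr rfl fun j _ => ?_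
      simp
    rw [@norm_eq_sqrt_re_inner ℂ, @norm_eq_sqrt_re_inner ℂ, h]
  obtain ⟨S, h1, h2, h3⟩ := exists_contraction_of_norm_eq _ _ hnorm
  refine ⟨S, h1, fun j x => ?_, fun j x => ?_⟩
  · rw [← hsingle, ← hsingle, h2]
  · rw [← hsingle, ← hsingle, h3]

/-- Consecutive blocks of a pure element differ by a scalar factor. -/
theorem IsPureElement.exists_block_succ {T : toeplitz (n + 1) ⊗[ℂ] (H →L[ℂ] H)}
    (hT : IsPureElement (minPositiveCone (n + 1) H) T) :
    ∃ a : ℂ, ∀ (i : Fin (n + 1)) (j : Fin n),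
      block i j.succ (spatialRep (n + 1) H T) = a • block i j.castSucc (spatialRep (n + 1) H T) ∧
      block i j.castSucc (spatialRep (n + 1) H T) =
        (starRingEnd ℂ a) • block i j.succ (spatialRep (n + 1) H T) := by
  obtain ⟨W, hW⟩ := ContinuousLinearMap.IsPositive.exists_adjoint_comp_self hT.1
  have hTo := isBlockToeplitz_spatialRep T
  rw [hW] at hTo
  obtain ⟨S, hS, hS1, hS2⟩ := hTo.exists_shift
  set X := adjoint W ∘L S ∘L W with hX
  set Y := adjoint W ∘L adjoint S ∘L W with hY
  -- `⟨W_{i+1} x, S W_{j+1} y⟩ = ⟨S† W_{i+1} x, W_{j+1} y⟩ = ⟨W_i x, S W_j y⟩`.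
  have hXt : IsBlockToeplitz X := isBlockToeplitz_of_succ fun i j => by
    ext y
    refine ext_inner_left ℂ fun x => ?_
    rw [hX, inner_block_conj, inner_block_conj, ← adjoint_inner_left, hS2, hS1]
  have hYt : IsBlockToeplitz Y := isBlockToeplitz_of_succ fun i j => by
    ext y
    refine ext_inner_left ℂ fun x => ?_
    rw [hY, inner_block_conj, inner_block_conj, hS2, adjoint_inner_right, hS1]
  have hexp : ∀ c : ℂ, adjoint W ∘L (2 • ContinuousLinearMap.id ℂ _ + (c • S +
      (starRingEnd ℂ c) • adjoint S)) ∘L W =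
      (2 : ℂ) • spatialRep (n + 1) H T + (c • X + (starRingEnd ℂ c) • Y) := by
    intro c
    rw [hW, hX, hY]
    ext1 ξ
    simp [two_smul]
  have hsum : ∀ c : ℂ, ‖c‖ = 1 → ∃ r : ℝ,
      c • X + (starRingEnd ℂ c) • Y = (r : ℂ) • spatialRep (n + 1) H T := by
    intro c hc
    have hpos : ∀ c : ℂ, ‖c‖ = 1 →
        ((2 : ℂ) • spatialRep (n + 1) H T + (c • X + (starRingEnd ℂ c) • Y)).IsPositive := by
      intro c hc
      rw [← hexp]
      exact (isPositive_two_add_smul_add_adjoint hS hc).adjoint_conj W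
    have hto : ∀ c : ℂ,
        IsBlockToeplitz ((2 : ℂ) • spatialRep (n + 1) H T + (c • X + (starRingEnd ℂ c) • Y)) :=
      fun c => ((isBlockToeplitz_spatialRep T).smul _).add ((hXt.smul _).add (hYt.smul _))
    obtain ⟨r, hr⟩ := hT.exists_eq_smul (hpos c hc) (hpos (-c) (by rwa [norm_neg])) (hto c)
      (hto (-c)) (c := 4) (by norm_num) (by
        rw [map_neg]
        push_cast
        module)
    refine ⟨r - 2, ?_⟩
    push_cast
    rw [eq_sub_of_add_eq' hr]
    module
  -- `X + Y = pT` and `iX - iY = qT` with `p`, `q` real, so `X` and `Y` have conjugate coefficients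
  -- `(p ∓ iq)/2`.
  obtain ⟨p, hp⟩ := hsum 1 (by simp)
  obtain ⟨q, hq⟩ := hsum Complex.I (by simp)
  simp only [map_one, one_smul, Complex.conj_I] at hp hq
  have hI : Complex.I * Complex.I = -1 := Complex.I_mul_I
  have hXa : X = ((p - Complex.I * q) / 2) • spatialRep (n + 1) H T := by
    have h : (2 : ℂ) • X = (X + Y) - Complex.I • (Complex.I • X + (-Complex.I) • Y) := by
      rw [smul_add, smul_smul, smul_smul, mul_neg, hI]
      module
    rw [hp, hq, smul_smul, ← sub_smul] at h
    rw [div_eq_inv_mul, mul_smul, ← h, smul_smul]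
    simp
  have hYa : Y = (starRingEnd ℂ ((p - Complex.I * q) / 2)) • spatialRep (n + 1) H T := by
    have h : (2 : ℂ) • Y = (X + Y) + Complex.I • (Complex.I • X + (-Complex.I) • Y) := by
      rw [smul_add, smul_smul, smul_smul, mul_neg, hI]
      module
    rw [hp, hq, smul_smul, ← add_smul] at h
    simp only [map_div₀, map_sub, map_mul, Complex.conj_ofReal, Complex.conj_I, map_ofNat]
    rw [neg_mul, sub_neg_eq_add, div_eq_inv_mul, mul_smul, ← h, smul_smul]
    simp
  refine ⟨(p - Complex.I * q) / 2, fun i j => ⟨?_, ?_⟩⟩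
  · rw [← map_smul, ← hXa]
    ext y
    refine ext_inner_left ℂ fun x => ?_
    rw [hX, inner_block_conj, hS1, hW, inner_block, comp_apply, adjoint_inner_right]
  · rw [← map_smul, ← hYa]
    ext y
    refine ext_inner_left ℂ fun x => ?_
    rw [hY, inner_block_conj, hS2, hW, inner_block, comp_apply, adjoint_inner_right]

/-- A pure element is an elementary tensor with a universal positive Toeplitz matrix. -/
theorem IsPureElement.exists_eq_tmul {T : toeplitz (n + 1) ⊗[ℂ] (H →L[ℂ] H)}
    (hT : IsPureElement (minPositiveCone (n + 1) H) T) :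
    ∃ (z : Circle) (P : H →L[ℂ] H), P.IsPositive ∧ T = universalToeplitz (n + 1) z⁻¹ ⊗ₜ P := by
  obtain ⟨a, ha⟩ := hT.exists_block_succ
  obtain ⟨τ, hτ⟩ := isBlockToeplitz_spatialRep T
  set G := spatialRep (n + 1) H T with hG
  have hpow : ∀ (i : Fin (n + 1)) (j : ℕ) (hj : j < n + 1),
      block i ⟨j, hj⟩ G = a ^ j • block i 0 G ∧
      block i 0 G = (starRingEnd ℂ a) ^ j • block i ⟨j, hj⟩ G := by
    intro i j
    induction j with
    | zero => exact fun hj => by simp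
    | succ j ih =>
      intro hj
      obtain ⟨h1, h2⟩ := ih (by omega)
      obtain ⟨h3, h4⟩ := ha i ⟨j, by omega⟩
      constructor
      · refine h3.trans ?_
        rw [pow_succ', mul_smul, ← h1]
        rfl
      · rw [pow_succ, mul_smul, h2]
        exact congrArg _ h4
  -- Pass from column `j` to column `0`, then from column `0` to column `i`, and use that diagonal
  -- blocks agree.
  have hij : ∀ i j : Fin (n + 1),
      block i j G = (a ^ (j : ℕ) * (starRingEnd ℂ a) ^ (i : ℕ)) • block 0 0 G := by
    intro i j
    rw [(hpow i j j.2).1, (hpow i i i.2).2, mul_smul, hτ, hτ 0 0]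
    simp
  have hpos : (block 0 0 G).IsPositive := by
    rw [block_eq_adjoint_comp]
    exact ContinuousLinearMap.IsPositive.adjoint_conj hT.1 _
  have hz : ∃ z : Circle, ∀ i j : Fin (n + 1),
      block i j G = ((z⁻¹ : Circle) : ℂ) ^ ((i : ℤ) - (j : ℤ)) • block 0 0 G := by
    by_cases hP : block 0 0 G = 0
    · exact ⟨1, fun i j => by rw [hij, hP, smul_zero, smul_zero]⟩
    rcases Nat.eq_zero_or_pos n with rfl | hn
    · exact ⟨1, fun i j => by
        rw [Fin.fin_one_eq_zero i, Fin.fin_one_eq_zero j]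
        simp⟩
    -- Moving one column forward and back multiplies the nonzero block by `āa`.
    have hna : a * starRingEnd ℂ a = 1 := by
      have h1 : block 0 0 G = (starRingEnd ℂ a ^ 1 * a ^ 1) • block 0 0 G := by
        rw [mul_smul, ← (hpow 0 1 (by omega)).1, ← (hpow 0 1 (by omega)).2]
      have h2 : (1 - starRingEnd ℂ a ^ 1 * a ^ 1) • block 0 0 G = 0 := by
        rw [sub_smul, ← h1, one_smul, sub_self]
      rcases smul_eq_zero.mp h2 with h | h
      · rw [sub_eq_zero, pow_one, pow_one] at h
        rw [h, mul_comm]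
      · exact absurd h hP
    have hnorm : ‖a‖ = 1 := by
      rw [Complex.mul_conj, Complex.normSq_eq_norm_sq] at hna
      have : ‖a‖ ^ 2 = 1 := by exact_mod_cast hna
      exact (pow_eq_one_iff_of_nonneg (norm_nonneg a) two_ne_zero).mp this
    have ha0 : a ≠ 0 := left_ne_zero_of_mul_eq_one hna
    obtain ⟨z, rfl⟩ : ∃ z : Circle, (z : ℂ) = a :=
      ⟨⟨a, mem_sphere_zero_iff_norm.mpr hnorm⟩, rfl⟩
    refine ⟨z, fun i j => ?_⟩
    rw [hij]
    congr 1
    rw [eq_inv_of_mul_eq_one_right hna, Circle.coe_inv,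
      zpow_sub₀ (inv_ne_zero ha0), zpow_natCast, zpow_natCast, inv_pow, inv_pow]
    field_simp
  obtain ⟨z, hz⟩ := hz
  refine ⟨z, block 0 0 G, hpos, spatialRep_injective (block_ext fun i j => ?_)⟩
  rw [spatialRep_tmul, block_kroneckerOp, ← hG, hz]
  rfl

/-- The map `x ↦ (1, z, …, z ^ (n - 1)) ⊗ x`. -/
def characterIncl (n : ℕ) (H : Type*) [NormedAddCommGroup H] [InnerProductSpace ℂ H]
    (z : Circle) : H →L[ℂ] HilbertPower n H :=
  ∑ i : Fin n, (z : ℂ) ^ (i : ℕ) • blockIncl i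

/-- `T_n(z)` is the rank-one matrix `ζ ζ*` with `ζ = (1, z, …, z ^ (n - 1))`. Both positivity and
the rank-one form used for purity follow from this. -/
theorem spatialRep_universalToeplitz_tmul (z : Circle) (P : H →L[ℂ] H) :
    spatialRep n H (universalToeplitz n z ⊗ₜ P) =
      characterIncl n H z ∘L P ∘L adjoint (characterIncl n H z) := by
  have hz : (z : ℂ) ≠ 0 := Circle.coe_ne_zero z
  refine block_ext fun i j => ?_
  have h : ∀ (i : Fin n) (x : H), adjoint (characterIncl n H z) (blockIncl i x) =
      (starRingEnd ℂ (z : ℂ)) ^ (i : ℕ) • x := by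
    intro i x
    refine ext_inner_left ℂ fun y => ?_
    rw [adjoint_inner_right, ← inner_conj_symm, inner_blockIncl_left]
    simp [characterIncl, blockIncl_apply, inner_smul_right]
  ext x
  rw [spatialRep_tmul, block_kroneckerOp, block_apply, comp_apply, comp_apply, h]
  simp only [characterIncl, universalToeplitz, Matrix.of_apply, smul_apply, sum_apply,
    WithLp.ofLp_sum, WithLp.ofLp_smul, Finset.sum_apply, Pi.smul_apply, blockIncl_apply,
    map_smul]
  rw [Finset.sum_eq_single i]
  · rw [if_pos rfl, smul_smul, ← Circle.coe_inv_eq_conj, Circle.coe_inv, inv_pow, zpow_sub₀ hz,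
      zpow_natCast, zpow_natCast, div_eq_mul_inv, mul_comm]
  · intro k _ hk
    rw [if_neg hk.symm, smul_zero]
  · simp

theorem universalToeplitz_tmul_mem (z : Circle) {P : H →L[ℂ] H} (hP : P.IsPositive) :
    universalToeplitz n z ⊗ₜ[ℂ] P ∈ minPositiveCone n H := by
  change (spatialRep n H _).IsPositive
  rw [spatialRep_universalToeplitz_tmul]
  exact hP.conj_adjoint _

open InnerProductSpace in
theorem isPureElement_universalToeplitz_tmul (z : Circle) (v : H) :
    IsPureElement (minPositiveCone (n + 1) H)
      (universalToeplitz (n + 1) z ⊗ₜ (rankOne ℂ v v)) := by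
  have hrep : spatialRep (n + 1) H (universalToeplitz (n + 1) z ⊗ₜ (rankOne ℂ v v)) =
      rankOne ℂ (characterIncl (n + 1) H z v) (characterIncl (n + 1) H z v) := by
    rw [spatialRep_universalToeplitz_tmul, rankOne_comp, comp_rankOne, adjoint_adjoint]
  refine ⟨universalToeplitz_tmul_mem z (isPositive_rankOne_self v), fun ϑ hϑ ω hω h => ?_⟩
  obtain ⟨s, hs, hs'⟩ := exists_eq_smul_rankOne_of_add_eq (A := spatialRep (n + 1) H ϑ)
    (B := spatialRep (n + 1) H ω) hϑ hω (by rw [← map_add, h, hrep])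
  have hsϑ : ϑ = s • (universalToeplitz (n + 1) z ⊗ₜ (rankOne ℂ v v)) := by
    apply spatialRep_injective
    rw [spatialRep_real_smul, hrep, hs']
  refine ⟨s, hs, hsϑ, ?_⟩
  rw [sub_smul, one_smul, ← hsϑ, ← h, add_sub_cancel_left]

open InnerProductSpace in
theorem exists_real_smul_projection (c : ℝ) (hc : 0 ≤ c) {w : H} (hw : w ≠ 0) :
    ∃ (Q : H →L[ℂ] H) (α : ℝ), IsRankOneProjection Q ∧ 0 ≤ α ∧ c • rankOne ℂ w w = α • Q := by
  have hw' : (‖w‖ : ℂ) ≠ 0 := by simpa using hw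
  refine ⟨rankOne ℂ ((‖w‖ : ℂ)⁻¹ • w) ((‖w‖ : ℂ)⁻¹ • w), c * ‖w‖ ^ 2,
    isRankOneProjection_rankOne (by simp [norm_smul, hw]), by positivity, ?_⟩
  ext x
  rw [smul_apply, smul_apply, rankOne_apply, rankOne_apply, inner_smul_left, smul_smul,
    ← Complex.coe_smul, ← Complex.coe_smul, smul_smul, smul_smul]
  congr 1
  simp
  field_simp

open InnerProductSpace in
theorem IsPureElement.exists_eq_real_smul_projection [Nontrivial H] {z : Circle} {P : H →L[ℂ] H}
    (hP : P.IsPositive)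
    (hT : IsPureElement (minPositiveCone (n + 1) H) (universalToeplitz (n + 1) z ⊗ₜ P)) :
    ∃ (Q : H →L[ℂ] H) (α : ℝ), IsRankOneProjection Q ∧ 0 ≤ α ∧ P = α • Q := by
  by_cases h0 : P = 0
  · obtain ⟨w, hw⟩ := exists_ne (0 : H)
    simpa [h0] using exists_real_smul_projection 0 le_rfl hw
  obtain ⟨x, hx⟩ : ∃ x, P x ≠ 0 := by
    by_contra! h
    exact h0 (ContinuousLinearMap.ext h)
  set t : ℝ := (inner ℂ x (P x)).re with ht
  have ht0 : 0 ≤ t := hP.re_inner_nonneg_right x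
  have htne : t ≠ 0 := fun h => hx (hP.apply_eq_zero (Complex.ext h (by
    rw [← hP.inner_left_eq_inner_right]
    exact hP.isSymmetric.im_inner_apply_self x)))
  set ρ : H →L[ℂ] H := ((t⁻¹ : ℝ) : ℂ) • rankOne ℂ (P x) (P x) with hρ
  have hρpos : ρ.IsPositive :=
    (isPositive_rankOne_self _).smul_of_nonneg (by exact_mod_cast inv_nonneg.mpr ht0)
  -- Purity is tested on the splitting `P = ρ + (P - ρ)`, tensored with the Toeplitz factor; block
  -- `(0, 0)` then recovers the second factor.
  obtain ⟨s, hs, hs', -⟩ := hT.2 _ (universalToeplitz_tmul_mem z hρpos) _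
    (universalToeplitz_tmul_mem z (hP.sub_rankOne x)) (by
      rw [← TensorProduct.tmul_add, hρ, add_sub_cancel])
  have hsP : ρ = (s : ℂ) • P := by
    have := congrArg (fun G => block 0 0 (spatialRep (n + 1) H G)) hs'
    simpa [spatialRep_real_smul, spatialRep_tmul, block_kroneckerOp, universalToeplitz] using this
  have hs0 : s ≠ 0 := by
    rintro rfl
    rw [hρ, Complex.ofReal_zero, zero_smul, smul_eq_zero, rankOne_eq_zero, or_self] at hsP
    exact hsP.elim (by simpa using htne) hx
  have hPeq : P = (s⁻¹ * t⁻¹) • rankOne ℂ (P x) (P x) := by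
    rw [mul_smul, ← Complex.coe_smul t⁻¹, ← hρ, hsP, Complex.coe_smul, smul_smul,
      inv_mul_cancel₀ hs0, one_smul]
  rw [hPeq]
  exact exists_real_smul_projection _ (mul_nonneg (inv_nonneg.mpr hs.1) (inv_nonneg.mpr ht0)) hx

theorem exists_isRankOneProjection [Nontrivial H] : ∃ Q : H →L[ℂ] H, IsRankOneProjection Q := by
  obtain ⟨q, hq⟩ := exists_norm_eq H (zero_le_one (α := ℝ))
  exact ⟨_, isRankOneProjection_rankOne hq⟩

end Purity

theorem mainTheorem2 (n : ℕ) (H : Type*) [NormedAddCommGroup H] [InnerProductSpace ℂ H]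
    [CompleteSpace H] [Nontrivial H] (T : toeplitz n ⊗[ℂ] (H →L[ℂ] H)) :
    IsPureElement (minPositiveCone n H) T ↔
      ∃ (z : Circle) (Q : H →L[ℂ] H) (α : ℝ), IsRankOneProjection Q ∧ 0 ≤ α ∧
        T = universalToeplitz n z⁻¹ ⊗ₜ[ℂ] (α • Q) := by
  cases n with
  | zero =>
    -- For `n = 0` the tensor product is zero and `α = 0` serves.
    have : Subsingleton (toeplitz 0) := inferInstance
    have hz : ∀ S : toeplitz 0 ⊗[ℂ] (H →L[ℂ] H), S = 0 := fun S => by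
      induction S with
      | zero => rfl
      | tmul a x => rw [Subsingleton.elim a 0, TensorProduct.zero_tmul]
      | add S T hS hT => rw [hS, hT, add_zero]
    refine ⟨fun _ => ?_, fun _ => ⟨?_, fun ϑ _ ω _ _ => ⟨0, by simp, ?_, ?_⟩⟩⟩
    · obtain ⟨Q, hQ⟩ := exists_isRankOneProjection (H := H)
      exact ⟨1, Q, 0, hQ, le_rfl, by rw [hz T, hz (_ ⊗ₜ _)]⟩
    · change (spatialRep 0 H T).IsPositive
      rw [hz T, map_zero]
      exact ContinuousLinearMap.isPositive_zero
    · rw [hz ϑ, hz (_ • T)]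
    · rw [hz ω, hz (_ • T)]
  | succ n =>
    constructor
    · intro hT
      obtain ⟨z, P, hP, rfl⟩ := hT.exists_eq_tmul
      obtain ⟨Q, α, hQ, hα, rfl⟩ := hT.exists_eq_real_smul_projection hP
      exact ⟨z, Q, α, hQ, hα, rfl⟩
    · rintro ⟨z, Q, α, hQ, hα, rfl⟩
      obtain ⟨q, -, rfl⟩ := hQ.exists_eq_rankOne
      rw [rankOne_real_smul α hα]
      exact isPureElement_universalToeplitz_tmul _ _

end
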